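/- An operational probabilistic theory (OPT) consists of a symmetric monoidal category, whose objects are called systems and whose morphisms $A\to B$ are called transformations ($\mathsf{Transf}(A\to B)$ denotes their set; states of $A$ are transformations $I\to A$ from the unit object $I$, and effects of $A$ are transformations $A\to I$); of a collection of tests (finite families of transformations with common input and output), closed under sequential composition, parallel composition and coarse-graining, and containing every identity as a one-outcome test; and of a map $\mathsf{Prob}:\mathsf{Transf}(I\to I)\to[0,1]$ with $\sum_x\mathsf{Prob}(s_x)=1$ for every test $(s_x)$ from $I$ to $I$ and $\mathsf{Prob}(s\otimes t)=\mathsf{Prob}(s)\,\mathsf{Prob}(t)$. It is assumed that two transformations $T,T':A\to B$ are equal whenever $\mathsf{Prob}(e\circ(T\otimes\mathcal I_E)\circ\rho)=\mathsf{Prob}(e\circ(T'\otimes\mathcal I_E)\circ\rho)$ for all systems $E$, states $\rho$ of $A\otimes E$ and effects $e$ of $B\otimes E$. Let $\mathsf{St}_{\mathbb R}(A)$ be the real vector space spanned by the states of $A$, regarded as functions $e\mapsto\mathsf{Prob}(e\circ\rho)$ on the effects of $A$. A transformation $T:A\to B$ induces a linear map $\widehat T:\mathsf{St}_{\mathbb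 R}(A)\to\mathsf{St}_{\mathbb R}(B)$. Let $\mathsf{Transf}_{\mathbb R}(A\to B)$ be the real vector space spanned by the transformations $T:A\to B$, regarded as families $(\widehat{T\otimes\mathcal I_E})_E$ indexed by all systems $E$. Put $\|\xi\|=\sup_{a}a(\xi)-\inf_{b}b(\xi)$ ($a,b$ effects of $A$) for $\xi\in\mathsf{St}_{\mathbb R}(A)$, and define the operational norm of $M\in\mathsf{Transf}_{\mathbb R}(A\to B)$ by $$\|M\|_{\rm op}=\sup_E\ \sup_{\rho}\ \frac{\|(M\otimes\mathcal I_E)\rho\|}{\|\rho\|},$$ where $\rho$ runs over the states of $A\otimes E$ with $\|\rho\|\neq0$ (and a supremum over the empty set is $0$). Assume that for all systems $A,B$ the space $\mathsf{Transf}_{\mathbb R}(A\to B)$ is finite-dimensional and the set $\mathsf{Transf}(A\to B)$ is convex in it and closed in it with respect to the operational norm. Let $A$ be a system and let $G_A$ be the group of reversible (that is, invertible) transformations $A\to A$, with the topology given by the operational norm. For a finite tuple of systems $E=(E_1,\dots,E_N)$ put $V_{A}=\bigoplus_{i=1}^N\mathsf{St}_{\mathbb R}(A\otimes E_i)$ and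 let $\pi_{A}:\mathsf{Transf}_{\mathbb R}(A\to A)\to L(V_{A})$ be the linear map to the linear operators on $V_A$ with $\pi_{A}(T)=\bigoplus_{i=1}^N\widehat{T\otimes\mathcal I_{E_i}}$ for all transformations $T:A\to A$. Then: 1. There are $N\ge1$ and systems $E_1,\dots,E_N$ such that $\pi_A$ is injective. 2. For every tuple $(E_1,\dots,E_N)$ such that $\pi_A$ is injective: $V_A$ is finite-dimensional; $\pi_A$ restricts to a faithful group representation $G_A\to GL(V_A)$; there is a norm on $L(V_A)$ for which $\pi_A$ is an isometry with respect to the operational norm; and $\pi_A(G_A)$ is a compact subset of $L(V_A)$. 3. $G_A$ is a compact Lie group: it is a compact Hausdorff topological group, and its topology underlies a finite-dimensional smooth real manifold structure for which multiplication and inversion are smooth. -/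

import Mathlib

open CategoryTheory MonoidalCategory
open scoped ContDiff

universe v u

noncomputable section

/-- Systems and transformations (the objects and morphisms of a symmetric monoidal category `C`),
tests (finite families of transformations with a common input and output), and the
probability of each scalar `𝟙_ C ⟶ 𝟙_ C`. -/
structure ProbTheory (C : Type u) [Category.{v} C] [MonoidalCategory C]
    [SymmetricCategory C] where
  /-- The tests with input `A`, output `B` and finite outcome set `ι`. -/
  IsTest : ∀ {A B : C} {ι : Type} [Finite ι], (ι → (A ⟶ B)) → Prop
  /-- The identity transformation is deterministic. -/
  isTest_id : ∀ A : C, IsTest (fun _ : Unit => 𝟙 A)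
  /-- Tests are closed under sequential composition. -/
  isTest_comp : ∀ {A B D : C} {ι κ : Type} [Finite ι] [Finite κ]
    (T : ι → (A ⟶ B)) (S : κ → (B ⟶ D)), IsTest T → IsTest S →
    IsTest (fun x : ι × κ => T x.1 ≫ S x.2)
  /-- Tests are closed under parallel composition. -/
  isTest_tensor : ∀ {A A' B B' : C} {ι κ : Type} [Finite ι] [Finite κ]
    (T : ι → (A ⟶ A')) (S : κ → (B ⟶ B')), IsTest T → IsTest S →
    IsTest (fun x : ι × κ => T x.1 ⊗ₘ S x.2)
  /-- The probability of a scalar. -/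
  prob : (𝟙_ C ⟶ 𝟙_ C) → ℝ
  prob_mem : ∀ s, prob s ∈ Set.Icc (0 : ℝ) 1
  /-- Consistency. -/
  sum_prob : ∀ {ι : Type} [Fintype ι] (s : ι → (𝟙_ C ⟶ 𝟙_ C)), IsTest s →
    ∑ x, prob (s x) = 1
  /-- Independence; the product of the scalars `s` and `t` is a scalar through `I ⊗ I ≅ I`. -/
  prob_tensor : ∀ s t : 𝟙_ C ⟶ 𝟙_ C,
    prob ((λ_ (𝟙_ C)).inv ≫ (s ⊗ₘ t) ≫ (λ_ (𝟙_ C)).hom) = prob s * prob t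

namespace ProbTheory

variable {C : Type u} [Category.{v} C] [MonoidalCategory C] [SymmetricCategory C]
variable (P : ProbTheory C)

/-- A state `ρ` of `A` as a function on the effects of `A`. -/
def stateFun {A : C} (ρ : 𝟙_ C ⟶ A) : (A ⟶ 𝟙_ C) → ℝ := fun e => P.prob (ρ ≫ e)

/-- The span of the states of `A`, as functions on the effects of `A`. -/
def stSpan (A : C) : Submodule ℝ ((A ⟶ 𝟙_ C) → ℝ) :=
  Submodule.span ℝ (Set.range (P.stateFun (A := A)))

/-- The real vector space `St_ℝ(A)` spanned by the states of `A`. -/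
def StR (A : C) : Type v := P.stSpan A

/-- The vector space structure of `St_ℝ(A)`: addition. -/
instance addCommGroupStR (A : C) : AddCommGroup (P.StR A) :=
  inferInstanceAs (AddCommGroup (P.stSpan A))

/-- The vector space structure of `St_ℝ(A)`: scalar multiplication. -/
instance moduleStR (A : C) : Module ℝ (P.StR A) :=
  inferInstanceAs (Module ℝ (P.stSpan A))

/-- A state of `A` as a vector of `St_ℝ(A)`. -/
def toStR {A : C} (ρ : 𝟙_ C ⟶ A) : P.StR A :=
  ⟨P.stateFun ρ, Submodule.subset_span ⟨ρ, rfl⟩⟩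

theorem StR_ext {A : C} {ξ η : P.StR A} (h : ∀ e, ξ.1 e = η.1 e) : ξ = η :=
  Subtype.ext (funext h)

theorem funLeft_mem_stSpan {A B : C} (T : A ⟶ B) (ξ : (A ⟶ 𝟙_ C) → ℝ) (hξ : ξ ∈ P.stSpan A) :
    LinearMap.funLeft ℝ ℝ (fun e : B ⟶ 𝟙_ C => T ≫ e) ξ ∈ P.stSpan B := by
  have h : P.stSpan A ≤ (P.stSpan B).comap
      (LinearMap.funLeft ℝ ℝ (fun e : B ⟶ 𝟙_ C => T ≫ e)) := by
    refine Submodule.span_le.2 ?_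
    rintro _ ⟨ρ, rfl⟩
    refine Submodule.subset_span ⟨ρ ≫ T, ?_⟩
    funext e
    simp [stateFun, LinearMap.funLeft]
  exact h hξ

/-- The linear map `St_ℝ(A) → St_ℝ(B)` induced by a transformation `T : A ⟶ B`;
it is determined by `ρ ↦ T ∘ ρ` on states, see `hat_toStR`. -/
def hat {A B : C} (T : A ⟶ B) : P.StR A →ₗ[ℝ] P.StR B :=
  (LinearMap.funLeft ℝ ℝ (fun e : B ⟶ 𝟙_ C => T ≫ e)).restrict (P.funLeft_mem_stSpan T)

theorem hat_apply {A B : C} (T : A ⟶ B) (ξ : P.StR A) (e : B ⟶ 𝟙_ C) :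
    (P.hat T ξ).1 e = ξ.1 (T ≫ e) := rfl

theorem hat_toStR {A B : C} (T : A ⟶ B) (ρ : 𝟙_ C ⟶ A) :
    P.hat T (P.toStR ρ) = P.toStR (ρ ≫ T) := by
  refine P.StR_ext fun e => ?_
  rw [hat_apply]
  simp [toStR, stateFun]

theorem hat_id (A : C) : P.hat (𝟙 A) = LinearMap.id := by
  refine LinearMap.ext fun ξ => P.StR_ext fun e => ?_
  simp [hat_apply]

theorem hat_comp {A B D : C} (T : A ⟶ B) (S : B ⟶ D) :
    P.hat (T ≫ S) = P.hat S ∘ₗ P.hat T := by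
  refine LinearMap.ext fun ξ => P.StR_ext fun e => ?_
  simp [hat_apply]

/-- A transformation `T : A ⟶ B` as the family, over all systems `E`, of the linear maps
induced by `T ⊗ I_E`. -/
def transfFun {A B : C} (T : A ⟶ B) : ∀ E : C, P.StR (A ⊗ E) →ₗ[ℝ] P.StR (B ⊗ E) :=
  fun E => P.hat (T ▷ E)

/-- The span of the transformations `A ⟶ B` in the space of all such families. -/
def transfSpan (A B : C) : Submodule ℝ (∀ E : C, P.StR (A ⊗ E) →ₗ[ℝ] P.StR (B ⊗ E)) :=
  Submodule.span ℝ (Set.range (P.transfFun (A := A) (B := B)))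

/-- The real vector space `Transf_ℝ(A → B)` spanned by the transformations `A ⟶ B`. It carries
the operational norm, introduced below. -/
def TransfR (A B : C) : Type (max u v) := P.transfSpan A B

/-- The vector space structure of `Transf_ℝ(A → B)`: addition. -/
instance addCommGroupTransfR (A B : C) : AddCommGroup (P.TransfR A B) :=
  inferInstanceAs (AddCommGroup (P.transfSpan A B))

/-- The vector space structure of `Transf_ℝ(A → B)`: scalar multiplication. -/
instance moduleTransfR (A B : C) : Module ℝ (P.TransfR A B) :=
  inferInstanceAs (Module ℝ (P.transfSpan A B))

/-- A transformation `A ⟶ B` as a vector of `Transf_ℝ(A → B)`. -/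
def toTransfR {A B : C} (T : A ⟶ B) : P.TransfR A B :=
  ⟨P.transfFun T, Submodule.subset_span ⟨T, rfl⟩⟩

/-- The action `M ⊗ I_E` of `M ∈ Transf_ℝ(A → B)` on `St_ℝ(A ⊗ E)`. -/
def act {A B : C} (E : C) : P.TransfR A B →ₗ[ℝ] (P.StR (A ⊗ E) →ₗ[ℝ] P.StR (B ⊗ E)) :=
  LinearMap.proj E ∘ₗ (P.transfSpan A B).subtype

theorem act_toTransfR {A B : C} (E : C) (T : A ⟶ B) :
    P.act E (P.toTransfR T) = P.hat (T ▷ E) := rfl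

/-- The operational norm on `St_ℝ(A)`. -/
def stNorm {A : C} (ξ : P.StR A) : ℝ :=
  (⨆ a : A ⟶ 𝟙_ C, ξ.1 a) - ⨅ b : A ⟶ 𝟙_ C, ξ.1 b

/-- The operational norm on `Transf_ℝ(A → B)`. -/
def opNorm {A B : C} (M : P.TransfR A B) : ℝ :=
  sSup {r : ℝ | ∃ (E : C) (ρ : 𝟙_ C ⟶ A ⊗ E), P.stNorm (P.toStR ρ) ≠ 0 ∧
    r = P.stNorm (P.act E M (P.toStR ρ)) / P.stNorm (P.toStR ρ)}

/- The next few facts show that the suprema above are finite and that `opNorm` is a seminorm. -/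

theorem StR_bounded {A : C} (ξ : P.StR A) : ∃ K : ℝ, ∀ a, |ξ.1 a| ≤ K := by
  obtain ⟨ξ, hξ⟩ := ξ
  induction hξ using Submodule.span_induction with
  | mem x hx =>
    obtain ⟨ρ, rfl⟩ := hx
    refine ⟨1, fun a => ?_⟩
    have := P.prob_mem (ρ ≫ a)
    exact abs_le.2 ⟨by simp only [stateFun]; linarith [this.1], this.2⟩
  | zero => exact ⟨0, fun a => by simp⟩
  | add x y _ _ hx hy =>
    obtain ⟨K, hK⟩ := hx
    obtain ⟨L, hL⟩ := hy
    exact ⟨K + L, fun a => (abs_add_le _ _).trans (add_le_add (hK a) (hL a))⟩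
  | smul c x _ hx =>
    obtain ⟨K, hK⟩ := hx
    refine ⟨|c| * K, fun a => ?_⟩
    simpa [abs_mul] using mul_le_mul_of_nonneg_left (hK a) (abs_nonneg c)

theorem StR_bddAbove {A : C} (ξ : P.StR A) : BddAbove (Set.range ξ.1) := by
  obtain ⟨K, hK⟩ := P.StR_bounded ξ
  exact ⟨K, by rintro _ ⟨a, rfl⟩; exact (abs_le.1 (hK a)).2⟩

theorem StR_bddBelow {A : C} (ξ : P.StR A) : BddBelow (Set.range ξ.1) := by
  obtain ⟨K, hK⟩ := P.StR_bounded ξ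
  exact ⟨-K, by rintro _ ⟨a, rfl⟩; exact (abs_le.1 (hK a)).1⟩

theorem sub_le_stNorm {A : C} (ξ : P.StR A) (a b : A ⟶ 𝟙_ C) :
    ξ.1 a - ξ.1 b ≤ P.stNorm ξ :=
  sub_le_sub (le_ciSup (P.StR_bddAbove ξ) a) (ciInf_le (P.StR_bddBelow ξ) b)

theorem stNorm_le {A : C} (ξ : P.StR A) {K : ℝ} (hK : 0 ≤ K)
    (h : ∀ a b, ξ.1 a - ξ.1 b ≤ K) : P.stNorm ξ ≤ K := by
  unfold stNorm
  rcases isEmpty_or_nonempty (A ⟶ 𝟙_ C) with hA | hA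
  · simpa using hK
  · have h1 : ∀ a, ξ.1 a - K ≤ ⨅ b, ξ.1 b := fun a => le_ciInf fun b => by linarith [h a b]
    have h2 : (⨆ a, ξ.1 a) ≤ K + ⨅ b, ξ.1 b := ciSup_le fun a => by linarith [h1 a]
    linarith

theorem stNorm_nonneg {A : C} (ξ : P.StR A) : 0 ≤ P.stNorm ξ := by
  rcases isEmpty_or_nonempty (A ⟶ 𝟙_ C) with hA | ⟨⟨a⟩⟩
  · simp [stNorm]
  · simpa using P.sub_le_stNorm ξ a a

theorem stNorm_add_le {A : C} (ξ η : P.StR A) :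
    P.stNorm (ξ + η) ≤ P.stNorm ξ + P.stNorm η :=
  P.stNorm_le _ (add_nonneg (P.stNorm_nonneg _) (P.stNorm_nonneg _)) fun a b => by
    have h1 := P.sub_le_stNorm ξ a b
    have h2 := P.sub_le_stNorm η a b
    change ξ.1 a + η.1 a - (ξ.1 b + η.1 b) ≤ _
    linarith

theorem stNorm_smul_le {A : C} (c : ℝ) (ξ : P.StR A) :
    P.stNorm (c • ξ) ≤ |c| * P.stNorm ξ :=
  P.stNorm_le _ (mul_nonneg (abs_nonneg _) (P.stNorm_nonneg _)) fun a b => by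
    change c * ξ.1 a - c * ξ.1 b ≤ _
    rw [← mul_sub]
    refine (le_abs_self _).trans ?_
    rw [abs_mul]
    refine mul_le_mul_of_nonneg_left (abs_le.2 ⟨?_, P.sub_le_stNorm ξ a b⟩) (abs_nonneg c)
    linarith [P.sub_le_stNorm ξ b a]

theorem stNorm_hat_le {A B : C} (T : A ⟶ B) (ξ : P.StR A) :
    P.stNorm (P.hat T ξ) ≤ P.stNorm ξ :=
  P.stNorm_le _ (P.stNorm_nonneg _) fun a b => P.sub_le_stNorm ξ (T ≫ a) (T ≫ b)

theorem act_bounded {A B : C} (M : P.TransfR A B) : ∃ K : ℝ, ∀ (E : C)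
    (ξ : P.StR (A ⊗ E)), P.stNorm (P.act E M ξ) ≤ K * P.stNorm ξ := by
  obtain ⟨M, hM⟩ := M
  change ∃ K : ℝ, ∀ (E : C) (ξ : P.StR (A ⊗ E)), P.stNorm (M E ξ) ≤ K * P.stNorm ξ
  induction hM using Submodule.span_induction with
  | mem x hx =>
    obtain ⟨T, rfl⟩ := hx
    exact ⟨1, fun E ξ => (P.stNorm_hat_le (T ▷ E) ξ).trans_eq (one_mul _).symm⟩
  | zero =>
    refine ⟨0, fun E ξ => ?_⟩
    simpa using P.stNorm_smul_le 0 (0 : P.StR (B ⊗ E))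
  | add x y _ _ hx hy =>
    obtain ⟨K, hK⟩ := hx
    obtain ⟨L, hL⟩ := hy
    refine ⟨K + L, fun E ξ => (P.stNorm_add_le (x E ξ) (y E ξ)).trans ?_⟩
    linarith [hK E ξ, hL E ξ]
  | smul c x _ hx =>
    obtain ⟨K, hK⟩ := hx
    refine ⟨|c| * K, fun E ξ => (P.stNorm_smul_le c (x E ξ)).trans ?_⟩
    rw [mul_assoc]
    exact mul_le_mul_of_nonneg_left (hK E ξ) (abs_nonneg c)

theorem div_le_opNorm {A B : C} (M : P.TransfR A B) (E : C) (ρ : 𝟙_ C ⟶ A ⊗ E)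
    (hρ : P.stNorm (P.toStR ρ) ≠ 0) :
    P.stNorm (P.act E M (P.toStR ρ)) / P.stNorm (P.toStR ρ) ≤ P.opNorm M := by
  refine le_csSup ?_ ⟨E, ρ, hρ, rfl⟩
  obtain ⟨K, hK⟩ := P.act_bounded M
  refine ⟨K, ?_⟩
  rintro _ ⟨E, ρ, hρ, rfl⟩
  exact (div_le_iff₀ ((P.stNorm_nonneg _).lt_of_ne' hρ)).2 (hK E _)

theorem opNorm_nonneg {A B : C} (M : P.TransfR A B) : 0 ≤ P.opNorm M := by
  refine Real.sSup_nonneg ?_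
  rintro _ ⟨E, ρ, -, rfl⟩
  exact div_nonneg (P.stNorm_nonneg _) (P.stNorm_nonneg _)

theorem opNorm_le {A B : C} (M : P.TransfR A B) {K : ℝ} (hK : 0 ≤ K)
    (h : ∀ (E : C) (ρ : 𝟙_ C ⟶ A ⊗ E), P.stNorm (P.toStR ρ) ≠ 0 →
      P.stNorm (P.act E M (P.toStR ρ)) / P.stNorm (P.toStR ρ) ≤ K) : P.opNorm M ≤ K := by
  refine Real.sSup_le ?_ hK
  rintro _ ⟨E, ρ, hρ, rfl⟩
  exact h E ρ hρ

/-- The operational norm on `Transf_ℝ(A → B)`, bundled as a seminorm. -/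
def opSeminorm (A B : C) : Seminorm ℝ (P.TransfR A B) :=
  Seminorm.ofSMulLE P.opNorm
    (le_antisymm
      (P.opNorm_le 0 le_rfl fun E ρ _ => by
        have h : P.stNorm (0 : P.StR (B ⊗ E)) ≤ 0 := by
          simpa using P.stNorm_smul_le 0 (0 : P.StR (B ⊗ E))
        rw [map_zero, LinearMap.zero_apply]
        exact div_nonpos_of_nonpos_of_nonneg h (P.stNorm_nonneg _))
      (P.opNorm_nonneg 0))
    (fun M N => P.opNorm_le _ (add_nonneg (P.opNorm_nonneg _) (P.opNorm_nonneg _))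
      fun E ρ hρ => by
        have h := P.stNorm_add_le (P.act E M (P.toStR ρ)) (P.act E N (P.toStR ρ))
        have h' := div_le_div_of_nonneg_right h (P.stNorm_nonneg (P.toStR ρ))
        rw [add_div] at h'
        rw [map_add, LinearMap.add_apply]
        exact h'.trans (add_le_add (P.div_le_opNorm M E ρ hρ) (P.div_le_opNorm N E ρ hρ)))
    (fun c M => P.opNorm_le _ (mul_nonneg (norm_nonneg _) (P.opNorm_nonneg _))
      fun E ρ hρ => by
        have h := P.stNorm_smul_le c (P.act E M (P.toStR ρ))
        have h' := div_le_div_of_nonneg_right h (P.stNorm_nonneg (P.toStR ρ))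
        rw [map_smul, LinearMap.smul_apply]
        rw [mul_div_assoc] at h'
        exact h'.trans
          (mul_le_mul_of_nonneg_left (P.div_le_opNorm M E ρ hρ) (abs_nonneg c)))

/-- `Transf_ℝ(A → B)` is topologized by the operational norm `‖M‖ = opNorm M`. -/
instance seminormedTransfR (A B : C) : SeminormedAddCommGroup (P.TransfR A B) :=
  (P.opSeminorm A B).toAddGroupSeminorm.toSeminormedAddCommGroup

theorem norm_eq_opNorm {A B : C} (M : P.TransfR A B) : ‖M‖ = P.opNorm M := rfl

/-- The group of reversible transformations of `A`, with composition `g * f = g ∘ f`. -/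
def Rev (_ : ProbTheory C) (A : C) : Type v := Aut A

/-- The group structure of the group of reversible transformations. -/
instance groupRev (A : C) : Group (P.Rev A) := inferInstanceAs (Group (Aut A))

/-- The transformation underlying an element of the group of reversible transformations. -/
def Rev.transf {P : ProbTheory C} {A : C} (g : P.Rev A) : A ⟶ A := Iso.hom g

/-- The group of reversible transformations carries the topology of the operational norm. -/
instance topologyRev (A : C) : TopologicalSpace (P.Rev A) :=
  TopologicalSpace.induced (fun g => P.toTransfR g.transf) inferInstance

/-- For systems `E₁, …, E_N`, the space `V_A = ⨁ᵢ St_ℝ(A ⊗ Eᵢ)`. -/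
abbrev RepSpace (A : C) {N : ℕ} (E : Fin N → C) : Type v := ∀ i, P.StR (A ⊗ E i)

/-- For systems `E₁, …, E_N`, the linear map `M ↦ ⨁ᵢ M ⊗ I_{Eᵢ}` from `Transf_ℝ(A → A)` to
the linear operators on `V_A`. -/
def rep (A : C) {N : ℕ} (E : Fin N → C) :
    P.TransfR A A →ₗ[ℝ] Module.End ℝ (P.RepSpace A E) where
  toFun M := LinearMap.pi fun i => P.act (E i) M ∘ₗ LinearMap.proj i
  map_add' M N := by
    refine LinearMap.ext fun ξ => funext fun i => ?_
    simp
  map_smul' c M := by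
    refine LinearMap.ext fun ξ => funext fun i => ?_
    simp

theorem rep_toTransfR (A : C) {N : ℕ} (E : Fin N → C) (T : A ⟶ A) (ξ : P.RepSpace A E)
    (i : Fin N) : P.rep A E (P.toTransfR T) ξ i = P.hat (T ▷ E i) (ξ i) := rfl

/-- The map `rep` on the group of reversible transformations, as a group representation. -/
def groupRep (A : C) {N : ℕ} (E : Fin N → C) :
    P.Rev A →* LinearMap.GeneralLinearGroup ℝ (P.RepSpace A E) :=
  MonoidHom.toHomUnits
    { toFun := fun g => P.rep A E (P.toTransfR g.transf)
      map_one' := by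
        refine LinearMap.ext fun ξ => funext fun i => ?_
        rw [rep_toTransfR]
        change P.hat (𝟙 A ▷ E i) (ξ i) = ξ i
        rw [id_whiskerRight, hat_id]
        rfl
      map_mul' := fun g h => by
        refine LinearMap.ext fun ξ => funext fun i => ?_
        rw [rep_toTransfR]
        change P.hat ((h.transf ≫ g.transf) ▷ E i) (ξ i) =
          P.hat (g.transf ▷ E i) (P.hat (h.transf ▷ E i) (ξ i))
        rw [comp_whiskerRight, hat_comp]
        rfl }

theorem coe_groupRep (A : C) {N : ℕ} (E : Fin N → C) (g : P.Rev A) :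
    (P.groupRep A E g : Module.End ℝ (P.RepSpace A E)) =
      P.rep A E (P.toTransfR g.transf) := rfl

end ProbTheory

/-- An operational probabilistic theory (a quotient theory: probabilistically equivalent
transformations are equal) whose tests are closed under coarse-graining. -/
structure OPT (C : Type u) [Category.{v} C] [MonoidalCategory C] [SymmetricCategory C]
    extends ProbTheory C where
  /-- Transformations with the same probabilities in all experiments are equal. -/
  quotient : ∀ {A B : C} (T T' : A ⟶ B),
    (∀ (E : C) (ρ : 𝟙_ C ⟶ A ⊗ E) (e : B ⊗ E ⟶ 𝟙_ C),
      prob (ρ ≫ T ▷ E ≫ e) = prob (ρ ≫ T' ▷ E ≫ e)) → T = T'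
  /-- Tests are closed under coarse-graining along a partition `J = ⋃ᵢ Jᵢ` of the outcomes,
  given by the map `f : J → I` with `Jᵢ = f ⁻¹ {i}`. -/
  coarseGraining : ∀ {A B : C} {I J : Type} [Fintype I] [Fintype J] [DecidableEq I]
    (f : J → I), Function.Surjective f → ∀ S : J → (A ⟶ B), IsTest S →
    ∃ T : I → (A ⟶ B), IsTest T ∧
      ∀ i, toProbTheory.toTransfR (T i) =
        ∑ j ∈ Finset.univ.filter (fun j => f j = i), toProbTheory.toTransfR (S j)

/-- Finite-dimensionality, convexity and closure of all the sets of transformations. -/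
structure OPT.FiniteConvexClosed {C : Type u} [Category.{v} C] [MonoidalCategory C]
    [SymmetricCategory C] (𝒪 : OPT C) : Prop where
  finite : ∀ A B : C, Module.Finite ℝ (𝒪.TransfR A B)
  convex : ∀ A B : C, Convex ℝ (Set.range (𝒪.toTransfR (A := A) (B := B)))
  /-- Closure with respect to the operational norm. -/
  closed : ∀ A B : C, IsClosed (Set.range (𝒪.toTransfR (A := A) (B := B)))

/-- A compact Lie group: a compact Hausdorff topological group whose topology underlies
a finite-dimensional smooth real manifold for which the group operations are smooth. -/
structure IsCompactLieGroup (G : Type*) [Group G] [TopologicalSpace G] : Prop where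
  isTopologicalGroup : IsTopologicalGroup G
  compactSpace : CompactSpace G
  t2Space : T2Space G
  lieGroup : ∃ (n : ℕ) (_ : ChartedSpace (EuclideanSpace ℝ (Fin n)) G),
    LieGroup (modelWithCornersSelf ℝ (EuclideanSpace ℝ (Fin n))) ∞ G

end

/-!
Two facts make the proof work.

*The operational norm is a norm, and the transformations form a compact set.* A priori `opNorm` is
only a seminorm. If it vanished at some `M ≠ 0`, every `T + t • M` with `T` a transformation would
lie in the closure of the set of transformations, hence be a transformation; but the probabilities
of `T + t • M` are affine in `t` and bounded, so `M = 0` (`ProbTheory.eq_zero_of_norm_eq_zero`).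
Transformations have norm at most `1`, so on the finite-dimensional space `Transf_ℝ(A → A)` they
form a compact set. The operators `M ⊗ I_E` together determine `M`, and by finite-dimensionality
finitely many `E` suffice (`ProbTheory.exists_injective_rep`); for such systems `Transf_ℝ(A → A)` embeds
in a matrix algebra. The reversible transformations are the compact set of those elements whose
inverse is again in the image of the transformations, so `G_A` is homeomorphic to a compact group
of matrices (`OPT.FiniteConvexClosed.isEmbedding_matrixRep_and_isCompact`).

*Compact matrix groups are Lie groups.* For a closed linear group `S`, the generators `X` of
one-parameter groups `exp (t • X)` in `S` form a subspace, because every limit `Y` of difference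
quotients `(g - 1) / ε` with `g ∈ S` and `ε → 0` is such a generator: `exp (t • Y)` is the limit of
`g ^ ⌊t / ε⌋` (`exp_smul_mem_of_tendsto`). With a projection `P` onto this subspace, the map
`Z ↦ exp (P Z) * (1 + (Z - P Z))` is an analytic diffeomorphism near `0`. Near `1`, an element of
`S` has vanishing normal part `Z - P Z`, since otherwise the directions of these normal parts would
accumulate at a generator complementary to all generators
(`eventually_mem_linearLieAlgebra`). This gives a chart of `S` around `1`, and its left translates
form an analytic atlas. A continuous map into the group is then analytic as soon as it is so as a
map into the matrix algebra (`LinearGroupChart.contMDiff_of_map_comp`), which applies to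
multiplication and inversion.
-/

/-! ### One-parameter subgroups of closed linear groups -/

section LinearLieGroup

open Filter Topology NormedSpace

variable {𝔸 : Type*} [NormedRing 𝔸] [NormedAlgebra ℝ 𝔸]

theorem exp_natCast_smul [CompleteSpace 𝔸] (n : ℕ) (X : 𝔸) : exp ((n : ℝ) • X) = exp X ^ n := by
  let _ := NormedAlgebra.restrictScalars ℚ ℝ 𝔸
  rw [Nat.cast_smul_eq_nsmul, exp_nsmul]

theorem continuous_exp_real [CompleteSpace 𝔸] : Continuous (exp : 𝔸 → 𝔸) := by
  let _ := NormedAlgebra.restrictScalars ℚ ℝ 𝔸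
  exact exp_continuous

theorem exp_mul_exp_neg [CompleteSpace 𝔸] (X : 𝔸) : exp X * exp (-X) = 1 := by
  let _ := NormedAlgebra.restrictScalars ℚ ℝ 𝔸
  rw [← exp_add_of_commute (Commute.refl X).neg_right, add_neg_cancel, exp_zero]

theorem exp_neg_mul_exp [CompleteSpace 𝔸] (X : 𝔸) : exp (-X) * exp X = 1 := by
  simpa using exp_mul_exp_neg (-X)

/-- If elements `g i` of a closed multiplicative set tend to `1` in the direction `Y`, then the
one-parameter semigroup generated by `Y` stays in the set: `exp (t • Y)` is the limit of the
powers `g i ^ ⌊t / ε i⌋`. -/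
theorem exp_smul_mem_of_tendsto [CompleteSpace 𝔸] {S : Submonoid 𝔸} (hS : IsClosed (S : Set 𝔸))
    {α : Type*} {l : Filter α} [l.NeBot] {g : α → 𝔸} {ε : α → ℝ} {Y : 𝔸}
    (hg : ∀ᶠ i in l, g i ∈ S) (hε : Tendsto ε l (𝓝[>] 0))
    (hY : Tendsto (fun i => (ε i)⁻¹ • (g i - 1)) l (𝓝 Y)) {t : ℝ} (ht : 0 ≤ t) :
    exp (t • Y) ∈ S := by
  have hexp : HasStrictFDerivAt (exp : 𝔸 → 𝔸)
      ((ContinuousLinearEquiv.refl ℝ 𝔸 : 𝔸 ≃L[ℝ] 𝔸) : 𝔸 →L[ℝ] 𝔸) 0 :=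
    hasStrictFDerivAt_exp_zero
  -- `L` is the logarithm near `1`.
  set L : 𝔸 → 𝔸 := hexp.localInverse
  have hL1 : L 1 = 0 := by
    have := hexp.localInverse_apply_image
    rwa [exp_zero] at this
  have hLd : HasFDerivAt L (ContinuousLinearMap.id ℝ 𝔸) 1 := by
    have := hexp.to_localInverse.hasFDerivAt
    rw [exp_zero] at this
    exact this
  have hLr : ∀ᶠ y in 𝓝 (1 : 𝔸), exp (L y) = y := by
    have := hexp.eventually_right_inverse
    rwa [exp_zero] at this
  have hinv : Tendsto (fun i => (ε i)⁻¹) l atTop := tendsto_inv_nhdsGT_zero.comp hε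
  have hpos : ∀ᶠ i in l, 0 < ε i := hε.eventually self_mem_nhdsWithin
  have hg1 : Tendsto g l (𝓝 1) := by
    have h := ((hε.mono_right nhdsWithin_le_nhds).smul hY).add_const (1 : 𝔸)
    rw [zero_smul, zero_add] at h
    refine h.congr' ?_
    filter_upwards [hpos] with i hi
    rw [smul_smul, mul_inv_cancel₀ hi.ne', one_smul, sub_add_cancel]
  have hlog : Tendsto (fun i => (ε i)⁻¹ • L (g i)) l (𝓝 Y) := by
    have h := (hLd.hasFDerivWithinAt (s := Set.univ)).lim (l := l) (c := fun i => (ε i)⁻¹)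
      (d := fun i => g i - 1) (v := Y) ?_ ?_ hY
    · simpa [hL1] using h
    · simpa using hg1.sub_const 1
    · simp
  have hfl : Tendsto (fun i => (⌊t * (ε i)⁻¹⌋₊ : ℝ) / (ε i)⁻¹) l (𝓝 t) :=
    (tendsto_nat_floor_mul_div_atTop ht).comp hinv
  have hlim : Tendsto (fun i => g i ^ ⌊t * (ε i)⁻¹⌋₊) l (𝓝 (exp (t • Y))) := by
    refine ((continuous_exp_real.tendsto _).comp (hfl.smul hlog)).congr' ?_
    filter_upwards [hpos, hg1.eventually hLr] with i hi hri
    simp only [Function.comp_apply]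
    rw [smul_smul, div_mul_cancel₀ _ (inv_ne_zero hi.ne'), exp_natCast_smul, hri]
  refine hS.mem_of_tendsto hlim ?_
  filter_upwards [hg] with i hi
  exact S.pow_mem hi _

variable {G : Type*} [Group G]

/-- If elements of the closed image of a group tend to `1` in the direction `Y`, the whole
one-parameter group generated by `Y` lies in the image. -/
theorem exp_smul_mem_mrange [CompleteSpace 𝔸] {ι : G →* 𝔸}
    (hι : IsClosed (MonoidHom.mrange ι : Set 𝔸))
    {α : Type*} {l : Filter α} [l.NeBot] {g : α → 𝔸} {ε : α → ℝ} {Y : 𝔸}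
    (hg : ∀ᶠ i in l, g i ∈ MonoidHom.mrange ι) (hε : Tendsto ε l (𝓝[>] 0))
    (hY : Tendsto (fun i => (ε i)⁻¹ • (g i - 1)) l (𝓝 Y)) (t : ℝ) :
    exp (t • Y) ∈ MonoidHom.mrange ι := by
  rcases le_total 0 t with ht | ht
  · exact exp_smul_mem_of_tendsto hι hg hε hY ht
  · obtain ⟨a, ha⟩ := exp_smul_mem_of_tendsto hι hg hε hY (neg_nonneg.2 ht)
    refine ⟨a⁻¹, ?_⟩
    have h1 : ι a⁻¹ * exp ((-t) • Y) = 1 := by rw [← ha, ← map_mul, inv_mul_cancel, map_one]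
    refine left_inv_eq_right_inv h1 ?_
    rw [neg_smul, exp_neg_mul_exp]

/-- The Lie algebra of a closed linear group, given as the image of a homomorphism `ι` into the
multiplicative monoid of a normed algebra: the generators of its one-parameter subgroups. -/
def linearLieAlgebra [CompleteSpace 𝔸] (ι : G →* 𝔸)
    (hι : IsClosed (MonoidHom.mrange ι : Set 𝔸)) : Submodule ℝ 𝔸 where
  carrier := {X | ∀ t : ℝ, exp (t • X) ∈ MonoidHom.mrange ι}
  zero_mem' t := by rw [smul_zero, exp_zero]; exact one_mem _
  smul_mem' c X hX t := by rw [smul_smul]; exact hX _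
  add_mem' := by
    intro X Y hX hY t
    -- The curve `s ↦ exp (s • X) * exp (s • Y)` has velocity `X + Y` at `0`.
    have hd : ∀ Z : 𝔸, HasDerivAt (fun s : ℝ => exp (s • Z)) Z 0 := fun Z => by
      have h := hasDerivAt_exp_smul_const (𝕂 := ℝ) Z (0 : ℝ)
      simpa using h
    have h := (hd X).mul (hd Y)
    have h' := h.tendsto_slope_zero_right
    refine exp_smul_mem_mrange hι (l := 𝓝[>] (0 : ℝ)) (ε := id)
      (g := fun s : ℝ => exp (s • X) * exp (s • Y))
      (Eventually.of_forall fun s => mul_mem (hX s) (hY s)) tendsto_id ?_ t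
    simpa using h'

theorem exp_mem_of_mem_linearLieAlgebra [CompleteSpace 𝔸] {ι : G →* 𝔸}
    {hι : IsClosed (MonoidHom.mrange ι : Set 𝔸)} {X : 𝔸} (hX : X ∈ linearLieAlgebra ι hι) :
    exp X ∈ MonoidHom.mrange ι := by
  simpa using hX 1

end LinearLieGroup

/-! ### Lie group structure from a chart around the identity -/

section ChartAtOne

open Filter Topology

variable {𝔸 : Type*} [NormedRing 𝔸] [NormedAlgebra ℝ 𝔸]
variable {F : Type*} [NormedAddCommGroup F] [NormedSpace ℝ F]

/-- A chart of a linear group around `1` compatible with the ambient algebra. The group is given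
by a homomorphism `ι` into the multiplicative monoid of the algebra; the chart `chart` is the
restriction of the analytic function `coord` on the open set `domain`, and its inverse is the
analytic parametrization `param`. -/
structure LinearGroupChart {G : Type*} [Group G] [TopologicalSpace G] (ι : G →* 𝔸)
    (F : Type*) [NormedAddCommGroup F] [NormedSpace ℝ F] where
  chart : OpenPartialHomeomorph G F
  domain : Set 𝔸
  isOpen_domain : IsOpen domain
  one_mem_domain : 1 ∈ domain
  coord : 𝔸 → F
  contDiffOn_coord : ContDiffOn ℝ ω coord domain
  param : F → 𝔸
  contDiff_param : ContDiff ℝ ω param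
  source_eq : chart.source = ι ⁻¹' domain
  chart_apply : ∀ h, chart h = coord (ι h)
  map_symm : ∀ x ∈ chart.target, ι (chart.symm x) = param x

namespace LinearGroupChart

open scoped Manifold

variable {G : Type*} [Group G] [TopologicalSpace G] {ι : G →* 𝔸}

theorem contDiffOn_coord_mul (c : LinearGroupChart ι F) (a : 𝔸) :
    ContDiffOn ℝ ω (fun y => c.coord (a * y)) ((fun y => a * y) ⁻¹' c.domain) :=
  c.contDiffOn_coord.comp (contDiff_const.mul contDiff_id).contDiffOn fun _ h => h

variable [IsTopologicalGroup G]

/-- The chart around `g`, obtained from the chart around `1` by left translation. -/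
def translate (c : LinearGroupChart ι F) (g : G) : OpenPartialHomeomorph G F :=
  (Homeomorph.mulLeft g⁻¹).toOpenPartialHomeomorph ≫ₕ c.chart

theorem translate_apply (c : LinearGroupChart ι F) (g h : G) :
    c.translate g h = c.coord (ι g⁻¹ * ι h) := by
  simp [translate, c.chart_apply]

theorem mem_translate_source (c : LinearGroupChart ι F) (g h : G) :
    h ∈ (c.translate g).source ↔ ι g⁻¹ * ι h ∈ c.domain := by
  simp [translate, c.source_eq]

theorem translate_target (c : LinearGroupChart ι F) (g : G) :
    (c.translate g).target = c.chart.target := by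
  simp [translate]

theorem map_translate_symm (c : LinearGroupChart ι F) (g : G) {x : F}
    (hx : x ∈ (c.translate g).target) : ι ((c.translate g).symm x) = ι g * c.param x := by
  rw [translate_target] at hx
  change ι (g⁻¹⁻¹ * c.chart.symm x) = _
  rw [inv_inv, map_mul, c.map_symm x hx]

/-- The atlas of left translates of a chart around `1`. -/
@[reducible] def chartedSpace (c : LinearGroupChart ι F) : ChartedSpace F G where
  atlas := Set.range c.translate
  chartAt := c.translate
  mem_chart_source g := by
    rw [mem_translate_source, ← map_mul, inv_mul_cancel, map_one]
    exact c.one_mem_domain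
  chart_mem_atlas g := ⟨g, rfl⟩

theorem isManifold (c : LinearGroupChart ι F) :
    letI := c.chartedSpace
    IsManifold 𝓘(ℝ, F) ω G := by
  let _ := c.chartedSpace
  refine isManifold_of_contDiffOn 𝓘(ℝ, F) ω G ?_
  rintro _ _ ⟨g, rfl⟩ ⟨h, rfl⟩
  have hmem : ∀ x ∈ ((c.translate g).symm ≫ₕ c.translate h).source,
      x ∈ (c.translate g).target ∧ ι h⁻¹ * (ι g * c.param x) ∈ c.domain := by
    intro x hx
    rw [OpenPartialHomeomorph.trans_source] at hx
    have h2 : (c.translate g).symm x ∈ (c.translate h).source := hx.2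
    rw [mem_translate_source, c.map_translate_symm g hx.1] at h2
    exact ⟨hx.1, h2⟩
  have key : ContDiffOn ℝ ω (fun x => c.coord (ι h⁻¹ * (ι g * c.param x)))
      ((c.translate g).symm ≫ₕ c.translate h).source :=
    (c.contDiffOn_coord_mul (ι h⁻¹)).comp
      (contDiff_const.mul c.contDiff_param).contDiffOn fun x hx => (hmem x hx).2
  refine (key.congr fun x hx => ?_).mono (fun x hx => hx.1)
  change c.translate h ((c.translate g).symm x) = _
  rw [translate_apply, c.map_translate_symm g (hmem x hx).1]

/-- The embedding into the algebra is analytic. -/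
theorem contMDiff_map (c : LinearGroupChart ι F) (hι : Continuous ι) :
    letI := c.chartedSpace
    ContMDiff 𝓘(ℝ, F) 𝓘(ℝ, 𝔸) ω ι := by
  let _ := c.chartedSpace
  intro g
  rw [contMDiffAt_iff]
  refine ⟨hι.continuousAt, ?_⟩
  have h : ContDiff ℝ ω fun x => ι g * c.param x := contDiff_const.mul c.contDiff_param
  refine (h.contDiffAt.congr_of_eventuallyEq ?_).contDiffWithinAt
  have ht : (c.translate g).target ∈ 𝓝 ((c.translate g) g) :=
    (c.translate g).open_target.mem_nhds
      ((c.translate g).map_source (c.chartedSpace.mem_chart_source g))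
  filter_upwards [ht] with x hx
  exact c.map_translate_symm g hx

/-- Analyticity of a map into the group can be tested in the algebra. -/
theorem contMDiff_of_map_comp (c : LinearGroupChart ι F)
    {E' H' M : Type*} [NormedAddCommGroup E'] [NormedSpace ℝ E'] [TopologicalSpace H']
    {I' : ModelWithCorners ℝ E' H'} [TopologicalSpace M] [ChartedSpace H' M] {k : M → G}
    (hk : Continuous k) (h : ContMDiff I' 𝓘(ℝ, 𝔸) ω (fun m => ι (k m))) :
    letI := c.chartedSpace
    ContMDiff I' 𝓘(ℝ, F) ω k := by
  let _ := c.chartedSpace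
  intro m
  rw [contMDiffAt_iff_target]
  refine ⟨hk.continuousAt, ?_⟩
  have h1 : ContDiffAt ℝ ω (fun y => c.coord (ι (k m)⁻¹ * y)) (ι (k m)) := by
    refine (c.contDiffOn_coord_mul _).contDiffAt
      ((c.isOpen_domain.preimage (continuous_const.mul continuous_id)).mem_nhds ?_)
    change ι (k m)⁻¹ * ι (k m) ∈ c.domain
    rw [← map_mul, inv_mul_cancel, map_one]
    exact c.one_mem_domain
  refine (ContMDiffAt.comp m h1.contMDiffAt h.contMDiffAt).congr_of_eventuallyEq ?_
  refine Eventually.of_forall fun m' => ?_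
  exact c.translate_apply (k m) (k m')

/-- Multiplication and inversion of the algebra are analytic, hence so are those of the group. -/
theorem lieGroup [CompleteSpace 𝔸] (c : LinearGroupChart ι F) (hι : Continuous ι) :
    letI := c.chartedSpace
    LieGroup 𝓘(ℝ, F) ω G := by
  let _ := c.chartedSpace
  have hman := c.isManifold
  have hsm := c.contMDiff_map hι
  refine { hman with contMDiff_mul := ?_, contMDiff_inv := ?_ }
  · refine c.contMDiff_of_map_comp continuous_mul ?_
    simp only [map_mul]
    have h1 := hsm.comp (contMDiff_fst (M := G) (N := G) (I := 𝓘(ℝ, F)) (J := 𝓘(ℝ, F)) (n := ω))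
    have h2 := hsm.comp (contMDiff_snd (M := G) (N := G) (I := 𝓘(ℝ, F)) (J := 𝓘(ℝ, F)) (n := ω))
    exact (contDiff_mul (𝕜 := ℝ) (𝔸 := 𝔸)).contMDiff.comp (h1.prodMk_space h2)
  · refine c.contMDiff_of_map_comp continuous_inv ?_
    intro g
    let u : 𝔸ˣ := Units.map ι (toUnits g)
    have hinv : ∀ h : G, ι h⁻¹ = Ring.inverse (ι h) := fun h => by
      have : ι h = ((Units.map ι (toUnits h) : 𝔸ˣ) : 𝔸) := rfl
      rw [this, Ring.inverse_unit, ← map_inv]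
      rfl
    have h1 : ContDiffAt ℝ ω Ring.inverse (ι g) := contDiffAt_ringInverse ℝ u
    refine (ContMDiffAt.comp g h1.contMDiffAt hsm.contMDiffAt).congr_of_eventuallyEq ?_
    exact Eventually.of_forall hinv

end LinearGroupChart

end ChartAtOne

/-! ### The closed subgroup theorem for compact linear groups -/

section ClosedSubgroup

open Filter Topology NormedSpace

/-- A group topologized by an embedding in the multiplicative monoid of a Banach algebra is a
topological group: inversion is continuous, being the restriction of the inversion of units. -/
theorem isTopologicalGroup_of_isEmbedding {𝔸 G : Type*} [NormedRing 𝔸] [CompleteSpace 𝔸] [Group G]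
    [TopologicalSpace G] {ι : G →* 𝔸}
    (hemb : IsEmbedding ι) : IsTopologicalGroup G where
  continuous_mul := by
    refine hemb.continuous_iff.2 ?_
    have h : Continuous fun p : G × G => ι p.1 * ι p.2 :=
      (hemb.continuous.comp continuous_fst).mul (hemb.continuous.comp continuous_snd)
    exact h.congr fun p => (map_mul ι _ _).symm
  continuous_inv := by
    refine hemb.continuous_iff.2 (continuous_iff_continuousAt.2 fun g => ?_)
    let u : G → 𝔸ˣ := fun h => Units.map ι (toUnits h)
    have hinv : ∀ h : G, Ring.inverse (ι h) = ι h⁻¹ := fun h => by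
      rw [show ι h = u h from rfl, Ring.inverse_unit, ← map_inv]
      rfl
    have h1 : ContinuousAt Ring.inverse (ι g) := NormedRing.inverse_continuousAt (u g)
    have h2 : ContinuousAt (fun h => Ring.inverse (ι h)) g :=
      ContinuousAt.comp h1 hemb.continuous.continuousAt
    exact h2.congr (Eventually.of_forall hinv)

variable {𝔸 : Type*} [NormedRing 𝔸] [NormedAlgebra ℝ 𝔸]

theorem contDiff_exp_real [CompleteSpace 𝔸] : ContDiff ℝ ω (exp : 𝔸 → 𝔸) :=
  contDiff_iff_contDiffAt.2 fun x => (exp_analytic (𝕂 := ℝ) x).contDiffAt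

/-- Tubular coordinates around `1` for a subspace `𝔤` with projection `P`: the tangential part
`P Z` is exponentiated and the normal part `Z - P Z` is kept linear. -/
noncomputable def tubularMap {𝔤 : Submodule ℝ 𝔸} (P : 𝔸 →L[ℝ] 𝔤) (Z : 𝔸) : 𝔸 :=
  exp (P Z : 𝔸) * (1 + (Z - P Z))

variable {𝔤 : Submodule ℝ 𝔸}

theorem tubularMap_zero (P : 𝔸 →L[ℝ] 𝔤) : tubularMap P 0 = 1 := by
  simp [tubularMap, exp_zero]

theorem tubularMap_coe {P : 𝔸 →L[ℝ] 𝔤} (hP : ∀ X : 𝔤, P X = X) (X : 𝔤) :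
    tubularMap P X = exp (X : 𝔸) := by
  simp [tubularMap, hP]

theorem contDiff_tubularMap [CompleteSpace 𝔸] (P : 𝔸 →L[ℝ] 𝔤) : ContDiff ℝ ω (tubularMap P) := by
  have h : ContDiff ℝ ω fun Z : 𝔸 => (P Z : 𝔸) := (𝔤.subtypeL.comp P).contDiff
  exact (contDiff_exp_real.comp h).mul (contDiff_const.add (contDiff_id.sub h))

theorem hasFDerivAt_tubularMap_zero [CompleteSpace 𝔸] (P : 𝔸 →L[ℝ] 𝔤) :
    HasFDerivAt (tubularMap P)
      ((ContinuousLinearEquiv.refl ℝ 𝔸 : 𝔸 ≃L[ℝ] 𝔸) : 𝔸 →L[ℝ] 𝔸) 0 := by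
  let q : 𝔸 →L[ℝ] 𝔸 := 𝔤.subtypeL.comp P
  have hq : HasFDerivAt q q 0 := q.hasFDerivAt
  have he : HasFDerivAt (exp : 𝔸 → 𝔸) (1 : 𝔸 →L[ℝ] 𝔸) (q 0) := by
    rw [map_zero]
    exact hasFDerivAt_exp_zero
  have h1 : HasFDerivAt (fun Z => exp (q Z)) q 0 := he.comp 0 hq
  have h2 : HasFDerivAt (fun Z => 1 + (Z - q Z)) (ContinuousLinearMap.id ℝ 𝔸 - q) 0 :=
    ((hasFDerivAt_id (𝕜 := ℝ) (0 : 𝔸)).sub hq).const_add 1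
  refine (h1.mul' h2).congr_fderiv ?_
  ext Z
  simp [exp_zero]

variable {G : Type*} [Group G] {ι : G →* 𝔸}

/-- Near `1`, elements of a closed linear group have no normal part. Otherwise the directions of
the normal parts accumulate at a unit vector generating a one-parameter subgroup of the group,
that is, at an element of the Lie algebra which the projection `P` kills. -/
theorem eventually_mem_linearLieAlgebra [FiniteDimensional ℝ 𝔸] [CompleteSpace 𝔸]
    (hι : IsClosed (MonoidHom.mrange ι : Set 𝔸)) {P : 𝔸 →L[ℝ] linearLieAlgebra ι hι}
    (hP : ∀ X : linearLieAlgebra ι hι, P X = X) {Ψ : 𝔸 → 𝔸} (hΨ : Tendsto Ψ (𝓝 1) (𝓝 0))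
    (hΨr : ∀ᶠ g in 𝓝 (1 : 𝔸), tubularMap P (Ψ g) = g) :
    ∀ᶠ g in 𝓝 (1 : 𝔸), g ∈ MonoidHom.mrange ι → Ψ g ∈ linearLieAlgebra ι hι := by
  by_contra hcon
  rw [not_eventually] at hcon
  set A : Set 𝔸 := {g | ¬(g ∈ MonoidHom.mrange ι → Ψ g ∈ linearLieAlgebra ι hι)}
  have : (𝓝 (1 : 𝔸) ⊓ 𝓟 A).NeBot := frequently_mem_iff_neBot.1 hcon
  set U := Ultrafilter.of (𝓝 (1 : 𝔸) ⊓ 𝓟 A)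
  have hU1 : (U : Filter 𝔸) ≤ 𝓝 1 := (Ultrafilter.of_le _).trans inf_le_left
  have hUA : ∀ᶠ g in (U : Filter 𝔸), g ∈ A :=
    (Ultrafilter.of_le (𝓝 (1 : 𝔸) ⊓ 𝓟 A)).trans inf_le_right (mem_principal_self A)
  let W : 𝔸 → 𝔸 := fun g => Ψ g - P (Ψ g)
  have hPW : ∀ g, P (W g) = 0 := fun g => by simp [W, hP]
  have hW0 : ∀ᶠ g in (U : Filter 𝔸), W g ≠ 0 := by
    filter_upwards [hUA] with g hg h
    refine hg fun _ => ?_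
    rw [sub_eq_zero.1 h]
    exact (P (Ψ g)).2
  have hΨU : Tendsto Ψ U (𝓝 0) := hΨ.mono_left hU1
  have hWlim : Tendsto W U (𝓝 0) := by
    have hc : Continuous fun Z : 𝔸 => Z - P Z :=
      continuous_id.sub (continuous_subtype_val.comp P.continuous)
    simpa [Function.comp_def] using (hc.tendsto 0).comp hΨU
  have hε : Tendsto (fun g => ‖W g‖) U (𝓝[>] 0) := by
    refine tendsto_nhdsWithin_iff.2 ⟨by simpa using hWlim.norm, ?_⟩
    filter_upwards [hW0] with g hg
    exact norm_pos_iff.2 hg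
  have hsph : ∀ᶠ g in (U : Filter 𝔸), ‖W g‖⁻¹ • W g ∈ Metric.sphere (0 : 𝔸) 1 := by
    filter_upwards [hW0] with g hg
    rw [mem_sphere_zero_iff_norm, norm_smul, norm_inv, norm_norm,
      inv_mul_cancel₀ (norm_ne_zero_iff.2 hg)]
  have := FiniteDimensional.proper_real 𝔸
  obtain ⟨Y, hY, hlim⟩ := (isCompact_sphere (0 : 𝔸) 1).ultrafilter_le_nhds
    (U.map fun g => ‖W g‖⁻¹ • W g) (le_principal_iff.2 hsph)
  have hlim : Tendsto (fun g => ‖W g‖⁻¹ • W g) U (𝓝 Y) := hlim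
  have hYmem : Y ∈ linearLieAlgebra ι hι := by
    refine exp_smul_mem_mrange hι (g := fun g => 1 + W g) ?_ hε (by simpa using hlim)
    filter_upwards [hUA, hU1 hΨr] with g hg hgr
    have hgS : g ∈ MonoidHom.mrange ι := by
      by_contra h
      exact hg fun h' => absurd h' h
    have : 1 + W g = exp (-(P (Ψ g) : 𝔸)) * g := by
      have h1 : exp (P (Ψ g) : 𝔸) * (1 + W g) = g := hgr
      calc 1 + W g = exp (-(P (Ψ g) : 𝔸)) * (exp (P (Ψ g) : 𝔸) * (1 + W g)) := by
            rw [← mul_assoc, exp_neg_mul_exp, one_mul]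
        _ = _ := by rw [h1]
    rw [this]
    exact mul_mem (exp_mem_of_mem_linearLieAlgebra (neg_mem (P (Ψ g)).2)) hgS
  have hPY : P Y = 0 := by
    refine tendsto_nhds_unique ((P.continuous.tendsto Y).comp hlim) ?_
    simp [Function.comp_def, hPW]
  have hY0 : Y = 0 := by
    have := hP ⟨Y, hYmem⟩
    rw [hPY] at this
    exact (congrArg Subtype.val this).symm
  rw [mem_sphere_zero_iff_norm, hY0, norm_zero] at hY
  exact zero_ne_one hY

/-- A group topologized by an injective homomorphism onto a closed subset of a finite-dimensional
algebra has a chart around `1`, given by the exponential map of its Lie algebra. -/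
theorem nonempty_linearGroupChart [FiniteDimensional ℝ 𝔸] [TopologicalSpace G]
    (hemb : IsEmbedding ι) (hι : IsClosed (MonoidHom.mrange ι : Set 𝔸)) :
    ∃ n : ℕ, Nonempty (LinearGroupChart ι (EuclideanSpace ℝ (Fin n))) := by
  have : CompleteSpace 𝔸 := FiniteDimensional.complete ℝ 𝔸
  let 𝔤 := linearLieAlgebra ι hι
  obtain ⟨P₀, hP₀⟩ := 𝔤.subtype.exists_leftInverse_of_injective (by simp)
  let P : 𝔸 →L[ℝ] 𝔤 := LinearMap.toContinuousLinearMap P₀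
  have hP : ∀ X : 𝔤, P X = X := fun X => LinearMap.congr_fun hP₀ X
  have hω : (ω : ℕ∞ω) ≠ 0 := by simp
  have hcd : ContDiffAt ℝ ω (tubularMap P) 0 := (contDiff_tubularMap P).contDiffAt
  have hd := hasFDerivAt_tubularMap_zero P
  let e : OpenPartialHomeomorph 𝔸 𝔸 := hcd.toOpenPartialHomeomorph (tubularMap P) hd hω
  have he : ∀ Z, e Z = tubularMap P Z := fun Z => rfl
  have he0 : (0 : 𝔸) ∈ e.source := hcd.mem_toOpenPartialHomeomorph_source hd hω
  have he1 : (1 : 𝔸) ∈ e.target := by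
    rw [← tubularMap_zero P]
    exact e.map_source he0
  have hes1 : e.symm 1 = 0 := by
    rw [← tubularMap_zero P]
    exact e.left_inv he0
  have hsymm : ContDiffAt ℝ ω e.symm 1 := by
    have h := hcd.to_localInverse hd hω
    rwa [tubularMap_zero] at h
  have htend : Tendsto e.symm (𝓝 1) (𝓝 0) := by
    have h := (e.continuousAt_symm he1).tendsto
    rwa [hes1] at h
  have hright : ∀ᶠ g in 𝓝 (1 : 𝔸), tubularMap P (e.symm g) = g := by
    filter_upwards [e.open_target.mem_nhds he1] with g hg using e.right_inv hg
  obtain ⟨O, hO, hOopen, hO1⟩ := eventually_nhds_iff.1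
    ((eventually_mem_linearLieAlgebra hι hP htend hright).and
      ((hsymm.eventually (by simp)).and (e.open_target.mem_nhds he1)))
  let E : 𝔤 ≃L[ℝ] EuclideanSpace ℝ (Fin (Module.finrank ℝ 𝔤)) := toEuclidean
  let γ : EuclideanSpace ℝ (Fin (Module.finrank ℝ 𝔤)) → 𝔸 := fun x => exp (E.symm x : 𝔸)
  have hE : ContDiff ℝ ω fun x => (E.symm x : 𝔸) :=
    (𝔤.subtypeL.comp E.symm.toContinuousLinearMap).contDiff
  have hγ : ContDiff ℝ ω γ := contDiff_exp_real.comp hE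
  have hγe : ∀ x, e (E.symm x : 𝔸) = γ x := fun x => tubularMap_coe hP _
  choose s hs using fun x => exp_mem_of_mem_linearLieAlgebra (E.symm x).2
  have hs : ∀ x, ι (s x) = γ x := hs
  -- On the domain, the tubular coordinates of a group element lie in the Lie algebra.
  have hcoord : ∀ g ∈ ι ⁻¹' O, (P (e.symm (ι g)) : 𝔸) = e.symm (ι g) := fun g hg =>
    congrArg Subtype.val (hP ⟨_, (hO _ hg).1 ⟨g, rfl⟩⟩)
  have hleft : ∀ g ∈ ι ⁻¹' O, γ (E (P (e.symm (ι g)))) = ι g := fun g hg => by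
    rw [← hγe, E.symm_apply_apply, hcoord g hg, e.right_inv (hO _ hg).2.2]
  have hcont : ContinuousOn e.symm O := e.continuousOn_symm.mono fun y hy => (hO y hy).2.2
  refine ⟨_, ⟨{
    chart :=
      { toFun := fun g => E (P (e.symm (ι g)))
        invFun := s
        source := ι ⁻¹' O
        target := {x | (E.symm x : 𝔸) ∈ e.source ∧ γ x ∈ O}
        map_source' := fun g hg => ⟨by
          rw [E.symm_apply_apply, hcoord g hg]
          exact e.map_target (hO _ hg).2.2, by rwa [hleft g hg]⟩
        map_target' := fun x hx => by
          change ι (s x) ∈ O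
          rw [hs]
          exact hx.2
        left_inv' := fun g hg => hemb.injective (by rw [hs, hleft g hg])
        right_inv' := fun x hx => by
          rw [hs, ← hγe, e.left_inv hx.1, hP, E.apply_symm_apply]
        open_source := hOopen.preimage hemb.continuous
        open_target := (e.open_source.preimage
          (continuous_subtype_val.comp E.symm.continuous)).inter (hOopen.preimage hγ.continuous)
        continuousOn_toFun := (E.continuous.comp P.continuous).comp_continuousOn
          (hcont.comp hemb.continuous.continuousOn fun _ h => h)
        continuousOn_invFun := by
          refine (hemb.continuous_iff.2 ?_).continuousOn
          exact hγ.continuous.congr fun x => (hs x).symm }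
    domain := O
    isOpen_domain := hOopen
    one_mem_domain := hO1
    coord := fun y => E (P (e.symm y))
    contDiffOn_coord := fun y hy =>
      (E.toContinuousLinearMap.comp P).contDiff.contDiffAt.comp_contDiffWithinAt y
        (hO y hy).2.1.contDiffWithinAt
    param := γ
    contDiff_param := hγ
    source_eq := rfl
    chart_apply := fun _ => rfl
    map_symm := fun x _ => hs x }⟩⟩

/-- **Closed subgroup theorem** for compact groups of units of a finite-dimensional algebra. -/
theorem isCompactLieGroup_of_isEmbedding [FiniteDimensional ℝ 𝔸] [TopologicalSpace G]
    (hemb : IsEmbedding ι) (hcomp : IsCompact (Set.range ι)) : IsCompactLieGroup G := by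
  have : CompleteSpace 𝔸 := FiniteDimensional.complete ℝ 𝔸
  have hgrp : IsTopologicalGroup G := isTopologicalGroup_of_isEmbedding hemb
  obtain ⟨n, ⟨c⟩⟩ := nonempty_linearGroupChart hemb
    (by rw [MonoidHom.coe_mrange]; exact hcomp.isClosed)
  refine ⟨hgrp, ?_, hemb.t2Space, n, c.chartedSpace, ?_⟩
  · rw [← isCompact_univ_iff, hemb.isCompact_iff, Set.image_univ]
    exact hcomp
  · let _ := c.chartedSpace
    have := c.lieGroup hemb.continuous
    exact LieGroup.of_le (n := ω) le_top

end ClosedSubgroup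

/-! ### Finite-dimensional linear algebra -/

section LinearAlgebraFacts

/-- In an Artinian module, a family of linear maps that is jointly injective has a finite
subfamily that is jointly injective. -/
theorem exists_finset_forall_eq_zero {R M κ : Type*} [Ring R] [AddCommGroup M] [Module R M]
    [IsArtinian R M] {W : κ → Type*} [∀ i, AddCommGroup (W i)] [∀ i, Module R (W i)]
    (f : ∀ i, M →ₗ[R] W i) (hf : ∀ m, (∀ i, f i m = 0) → m = 0) :
    ∃ s : Finset κ, ∀ m, (∀ i ∈ s, f i m = 0) → m = 0 := by
  classical
  obtain ⟨_, ⟨s, rfl⟩, hs⟩ := (wellFounded_lt (α := Submodule R M)).has_min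
    (Set.range fun s : Finset κ => s.inf fun i => LinearMap.ker (f i)) ⟨_, ∅, rfl⟩
  refine ⟨s, fun m hm => hf m fun i => ?_⟩
  -- Adding a further index cannot shrink a minimal common kernel.
  have hle : (insert i s).inf (fun i => LinearMap.ker (f i)) ≤
      s.inf fun i => LinearMap.ker (f i) := Finset.inf_mono (Finset.subset_insert i s)
  have heq := hle.eq_of_not_lt (hs _ ⟨insert i s, rfl⟩)
  have hmem : m ∈ s.inf fun i => LinearMap.ker (f i) := by
    rw [Submodule.mem_finsetInf]
    exact hm
  rw [← heq, Finset.inf_insert] at hmem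
  exact hmem.1

/-- A norm on a space that is linearly embedded in a finite-dimensional space is the restriction
of a norm on the larger space. -/
theorem exists_seminorm_comp_eq {M W : Type*} [AddCommGroup M] [Module ℝ M] [AddCommGroup W]
    [Module ℝ W] [Module.Finite ℝ W] (p : Seminorm ℝ M) (hp : ∀ m, p m = 0 → m = 0)
    (f : M →ₗ[ℝ] W) (hf : Function.Injective f) :
    ∃ q : Seminorm ℝ W, (∀ w, q w = 0 → w = 0) ∧ ∀ m, q (f m) = p m := by
  obtain ⟨r, hr⟩ := f.exists_leftInverse_of_injective (LinearMap.ker_eq_bot.2 hf)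
  have hrf : ∀ m, r (f m) = m := fun m => LinearMap.congr_fun hr m
  let b := Module.finBasis ℝ W
  let n : Seminorm ℝ W :=
    (normSeminorm ℝ (Fin (Module.finrank ℝ W) → ℝ)).comp b.equivFun.toLinearMap
  have hn : ∀ w, n w = 0 → w = 0 := fun w hw => b.equivFun.map_eq_zero_iff.1 (norm_eq_zero.1 hw)
  -- The norm of the component along the image of `f`, plus a norm of the complementary one.
  refine ⟨p.comp r + n.comp (LinearMap.id - f ∘ₗ r), fun w hw => ?_, fun m => ?_⟩
  · have h : p (r w) + n (w - f (r w)) = 0 := hw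
    rw [add_eq_zero_iff_of_nonneg (apply_nonneg p _) (apply_nonneg n _)] at h
    have h2 := hn _ h.2
    rwa [hp _ h.1, map_zero, sub_zero] at h2
  · change p (r (f m)) + n (f m - f (r (f m))) = p m
    rw [hrf, sub_self, map_zero, add_zero]

end LinearAlgebraFacts

/-! ### The operational norm and the spaces of states and transformations -/

namespace ProbTheory

variable {C : Type u} [Category.{v} C] [MonoidalCategory C] [SymmetricCategory C]
variable (P : ProbTheory C)

theorem span_range_toStR (A : C) :
    Submodule.span ℝ (Set.range (P.toStR (A := A))) = ⊤ := by
  rw [eq_top_iff]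
  rintro ⟨ξ, hξ⟩ -
  induction hξ using Submodule.span_induction with
  | mem x hx =>
    obtain ⟨ρ, rfl⟩ := hx
    exact Submodule.subset_span ⟨ρ, rfl⟩
  | zero => exact Submodule.zero_mem _
  | add x y _ _ hx hy => exact Submodule.add_mem _ hx hy
  | smul c x _ hx => exact Submodule.smul_mem _ c hx

/-- A vector of `Transf_ℝ(A → B)` is determined by the probabilities it yields. -/
theorem eq_zero_of_act_toStR_apply {A B : C} {M : P.TransfR A B}
    (h : ∀ (E : C) (ρ : 𝟙_ C ⟶ A ⊗ E) (e : B ⊗ E ⟶ 𝟙_ C), (P.act E M (P.toStR ρ)).1 e = 0) :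
    M = 0 := by
  refine Subtype.ext (funext fun E => ?_)
  refine LinearMap.ext_on (P.span_range_toStR (A ⊗ E)) ?_
  rintro _ ⟨ρ, rfl⟩
  exact P.StR_ext (h E ρ)

theorem eq_zero_of_isEmpty_hom {A B : C} [IsEmpty (A ⟶ B)] (M : P.TransfR A B) :
    M = 0 := by
  obtain ⟨M, hM⟩ := M
  rw [transfSpan, Set.range_eq_empty, Submodule.span_empty, Submodule.mem_bot] at hM
  exact Subtype.ext hM

theorem opNorm_toTransfR_le {A B : C} (T : A ⟶ B) : ‖P.toTransfR T‖ ≤ 1 := by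
  rw [norm_eq_opNorm]
  refine P.opNorm_le _ zero_le_one fun E ρ _ => ?_
  rw [act_toTransfR]
  exact div_le_one_of_le₀ (P.stNorm_hat_le _ _) (P.stNorm_nonneg _)

/-- The scalar multiplication of `Transf_ℝ(A → B)` is compatible with the operational norm. -/
instance normedSpaceTransfR (A B : C) : NormedSpace ℝ (P.TransfR A B) where
  toModule := P.moduleTransfR A B
  norm_smul_le c M := (map_smul_eq_mul (P.opSeminorm A B) c M).le

/-- A closed set of transformations makes the operational norm definite: a line in its kernel
could be added to a transformation without leaving the set of transformations, but probabilities
are bounded. -/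
theorem eq_zero_of_norm_eq_zero {A B : C}
    (hcl : IsClosed (Set.range (P.toTransfR (A := A) (B := B)))) {M : P.TransfR A B}
    (hM : ‖M‖ = 0) : M = 0 := by
  rcases isEmpty_or_nonempty (A ⟶ B) with h | ⟨⟨T₀⟩⟩
  · exact P.eq_zero_of_isEmpty_hom M
  refine P.eq_zero_of_act_toStR_apply fun E ρ e => ?_
  set x : ℝ := (P.act E M (P.toStR ρ)).1 e
  set y : ℝ := P.prob (ρ ≫ T₀ ▷ E ≫ e)
  have hline : ∀ t : ℝ, y + t * x ∈ Set.Icc (0 : ℝ) 1 := fun t => by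
    have hmem : P.toTransfR T₀ + t • M ∈ Set.range (P.toTransfR (A := A) (B := B)) := by
      rw [← hcl.closure_eq, Metric.mem_closure_iff]
      refine fun ε hε => ⟨_, ⟨T₀, rfl⟩, ?_⟩
      rw [dist_eq_norm, add_sub_cancel_left, norm_smul, hM, mul_zero]
      exact hε
    obtain ⟨T, hT⟩ := hmem
    have h1 : (P.act E (P.toTransfR T) (P.toStR ρ)).1 e =
        (P.act E (P.toTransfR T₀ + t • M) (P.toStR ρ)).1 e := by rw [hT]
    rw [map_add, map_smul, LinearMap.add_apply, LinearMap.smul_apply] at h1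
    have h2 : P.prob (ρ ≫ T ▷ E ≫ e) = y + t * x := h1
    rw [← h2]
    exact P.prob_mem _
  by_contra hne
  have h1 := (hline ((2 - y) / x)).2
  rw [div_mul_cancel₀ _ hne] at h1
  linarith

/-- `St_ℝ(A)` is a quotient of `Transf_ℝ(I → A)`, since states are transformations out of `I`. -/
theorem finite_StR (A : C) [Module.Finite ℝ (P.TransfR (𝟙_ C) A)] : Module.Finite ℝ (P.StR A) := by
  let f : P.TransfR (𝟙_ C) A →ₗ[ℝ] P.StR A :=
    P.hat (ρ_ A).hom ∘ₗ (P.act (𝟙_ C)).flip (P.toStR (λ_ (𝟙_ C)).inv)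
  refine Module.Finite.of_surjective f (LinearMap.range_eq_top.1 ?_)
  rw [eq_top_iff, ← P.span_range_toStR A, Submodule.span_le]
  rintro _ ⟨σ, rfl⟩
  refine ⟨P.toTransfR σ, ?_⟩
  change P.hat (ρ_ A).hom (P.hat (σ ▷ 𝟙_ C) (P.toStR (λ_ (𝟙_ C)).inv)) = P.toStR σ
  rw [hat_toStR, hat_toStR]
  congr 1
  rw [Category.assoc, rightUnitor_naturality, unitors_inv_equal, Iso.inv_hom_id_assoc]

theorem rep_comp (A : C) {N : ℕ} (E : Fin N → C) (T S : A ⟶ A) :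
    P.rep A E (P.toTransfR (T ≫ S)) =
      P.rep A E (P.toTransfR S) * P.rep A E (P.toTransfR T) := by
  refine LinearMap.ext fun ξ => funext fun i => ?_
  rw [rep_toTransfR, comp_whiskerRight, hat_comp]
  rfl

theorem rep_id (A : C) {N : ℕ} (E : Fin N → C) : P.rep A E (P.toTransfR (𝟙 A)) = 1 := by
  refine LinearMap.ext fun ξ => funext fun i => ?_
  rw [rep_toTransfR, id_whiskerRight, hat_id]
  rfl

/-- Finitely many ancillary systems suffice to tell the vectors of a finite-dimensional
`Transf_ℝ(A → A)` apart. -/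
theorem exists_injective_rep (A : C) [Module.Finite ℝ (P.TransfR A A)] :
    ∃ (N : ℕ) (E : Fin N → C), 1 ≤ N ∧ Function.Injective (P.rep A E) := by
  classical
  obtain ⟨s, hs⟩ := exists_finset_forall_eq_zero (fun E : C => P.act (A := A) (B := A) E)
    fun M hM => Subtype.ext (funext hM)
  let t := insert A s
  refine ⟨t.card, fun i => (t.equivFin.symm i : C), ?_, ?_⟩
  · exact Finset.card_pos.2 ⟨A, Finset.mem_insert_self A s⟩
  · refine (injective_iff_map_eq_zero _).2 fun M hM => hs M fun E hE => ?_
    let i := t.equivFin ⟨E, Finset.mem_insert_of_mem hE⟩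
    have hi : (t.equivFin.symm i : C) = E := by simp [i]
    rw [← hi]
    refine LinearMap.ext fun ξ => ?_
    have h := congrFun (LinearMap.congr_fun hM (Pi.single i ξ)) i
    change P.act _ M (Pi.single (M := fun j => P.StR (A ⊗ (t.equivFin.symm j : C))) i ξ i) = 0 at h
    rwa [Pi.single_eq_same] at h

end ProbTheory

/-! ### Compactness of the group of reversible transformations -/

section CompactRepresentation

open Topology

variable {C : Type u} [Category.{v} C] [MonoidalCategory C] [SymmetricCategory C]

attribute [local instance] Matrix.linftyOpNormedRing Matrix.linftyOpNormedAlgebra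

theorem OPT.toTransfR_injective (𝒪 : OPT C) (A B : C) :
    Function.Injective (𝒪.toTransfR (A := A) (B := B)) := by
  refine fun T T' h => 𝒪.quotient T T' fun E ρ e => ?_
  have h1 : (𝒪.act E (𝒪.toTransfR T) (𝒪.toStR ρ)).1 e =
      (𝒪.act E (𝒪.toTransfR T') (𝒪.toStR ρ)).1 e := by rw [h]
  exact h1

theorem ProbTheory.Rev.transf_injective {P : ProbTheory C} {A : C} :
    Function.Injective (Rev.transf (P := P) (A := A)) := fun _ _ h => Iso.ext h

/-- The matrices, with respect to a basis of `V_A`, of the operators by which the reversible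
transformations act. -/
noncomputable def ProbTheory.matrixRep (P : ProbTheory C) (A : C) {N : ℕ} (E : Fin N → C)
    {d : ℕ} (b : Module.Basis (Fin d) ℝ (P.RepSpace A E)) : P.Rev A →* Matrix (Fin d) (Fin d) ℝ :=
  (LinearMap.toMatrixAlgEquiv b : _ →* _).comp ((Units.coeHom _).comp (P.groupRep A E))

theorem ProbTheory.matrixRep_apply (P : ProbTheory C) (A : C) {N : ℕ} (E : Fin N → C)
    {d : ℕ} (b : Module.Basis (Fin d) ℝ (P.RepSpace A E)) (g : P.Rev A) :
    P.matrixRep A E b g = LinearMap.toMatrixAlgEquiv b (P.rep A E (P.toTransfR g.transf)) := rfl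

variable {𝒪 : OPT C}

/-- The group is compact because transformations form a closed bounded set in a finite-dimensional
normed space, and the reversible ones among them are those whose inverse lies in the same
compact set. -/
theorem OPT.FiniteConvexClosed.isEmbedding_matrixRep_and_isCompact
    (h𝒪 : 𝒪.FiniteConvexClosed) {A : C} {N : ℕ} {E : Fin N → C}
    (hE : Function.Injective (𝒪.rep A E)) {d : ℕ}
    (b : Module.Basis (Fin d) ℝ (𝒪.RepSpace A E)) :
    IsEmbedding (𝒪.matrixRep A E b) ∧ IsCompact (Set.range (𝒪.matrixRep A E b)) := by
  have hfin : Module.Finite ℝ (𝒪.TransfR A A) := h𝒪.finite A A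
  let _ : NormedAddCommGroup (𝒪.TransfR A A) :=
    NormedAddCommGroup.ofSeparation fun M hM => 𝒪.eq_zero_of_norm_eq_zero (h𝒪.closed A A) hM
  let _ : NormedSpace ℝ (𝒪.TransfR A A) := { 𝒪.normedSpaceTransfR A A with }
  let f : 𝒪.TransfR A A →ₗ[ℝ] Matrix (Fin d) (Fin d) ℝ :=
    (LinearMap.toMatrixAlgEquiv b).toLinearMap ∘ₗ 𝒪.rep A E
  have hf : Function.Injective f := (LinearMap.toMatrixAlgEquiv b).injective.comp hE
  have hemb : IsClosedEmbedding f :=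
    LinearMap.isClosedEmbedding_of_injective (LinearMap.ker_eq_bot.2 hf)
  have hproper : ProperSpace (𝒪.TransfR A A) := FiniteDimensional.proper ℝ _
  have hK : IsCompact (f '' Set.range (𝒪.toTransfR (A := A) (B := A))) := by
    refine IsCompact.image ?_ hemb.continuous
    refine (isCompact_closedBall (0 : 𝒪.TransfR A A) 1).of_isClosed_subset (h𝒪.closed A A) ?_
    rintro _ ⟨T, rfl⟩
    rw [mem_closedBall_zero_iff]
    exact 𝒪.opNorm_toTransfR_le T
  have hcomp : ∀ T S : A ⟶ A,
      f (𝒪.toTransfR (T ≫ S)) = f (𝒪.toTransfR S) * f (𝒪.toTransfR T) := fun T S => by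
    simp only [f, LinearMap.comp_apply, ProbTheory.rep_comp]
    exact map_mul (LinearMap.toMatrixAlgEquiv b) _ _
  have hid : f (𝒪.toTransfR (𝟙 A)) = 1 := by
    simp only [f, LinearMap.comp_apply, ProbTheory.rep_id]
    exact map_one (LinearMap.toMatrixAlgEquiv b)
  constructor
  · refine ⟨hemb.isInducing.comp ⟨rfl⟩, ?_⟩
    exact hf.comp ((𝒪.toTransfR_injective A A).comp ProbTheory.Rev.transf_injective)
  · set K := f '' Set.range (𝒪.toTransfR (A := A) (B := A))
    have hrange : Set.range (𝒪.matrixRep A E b) =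
        Prod.fst '' ((K ×ˢ K) ∩ {x | x.1 * x.2 = 1 ∧ x.2 * x.1 = 1}) := by
      ext X
      constructor
      · rintro ⟨g, rfl⟩
        have h1 : 𝒪.matrixRep A E b g * 𝒪.matrixRep A E b g⁻¹ = 1 := by
          rw [← map_mul, mul_inv_cancel, map_one]
        have h2 : 𝒪.matrixRep A E b g⁻¹ * 𝒪.matrixRep A E b g = 1 := by
          rw [← map_mul, inv_mul_cancel, map_one]
        exact ⟨(𝒪.matrixRep A E b g, 𝒪.matrixRep A E b g⁻¹),
          ⟨⟨⟨_, ⟨g.transf, rfl⟩, rfl⟩, ⟨_, ⟨(g⁻¹).transf, rfl⟩, rfl⟩⟩, h1, h2⟩, rfl⟩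
      · rintro ⟨⟨_, _⟩, ⟨⟨⟨_, ⟨T, rfl⟩, rfl⟩, ⟨_, ⟨S, rfl⟩, rfl⟩⟩, h1, h2⟩, rfl⟩
        have hTS : T ≫ S = 𝟙 A := 𝒪.toTransfR_injective A A (hf (by
          rw [hcomp, hid]; exact h2))
        have hST : S ≫ T = 𝟙 A := 𝒪.toTransfR_injective A A (hf (by
          rw [hcomp, hid]; exact h1))
        exact ⟨(⟨T, S, hTS, hST⟩ : A ≅ A), rfl⟩
    rw [hrange]
    refine ((hK.prod hK).inter_right ?_).image continuous_fst
    exact (isClosed_eq (continuous_fst.mul continuous_snd) continuous_const).inter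
      (isClosed_eq (continuous_snd.mul continuous_fst) continuous_const)

end CompactRepresentation

theorem mainTheorem10 {C : Type u} [Category.{v} C] [MonoidalCategory C] [SymmetricCategory C]
    (𝒪 : OPT C) (h𝒪 : 𝒪.FiniteConvexClosed) (A : C) :
    (∃ (N : ℕ) (E : Fin N → C), 1 ≤ N ∧ Function.Injective (𝒪.rep A E)) ∧
    (∀ (N : ℕ) (E : Fin N → C), Function.Injective (𝒪.rep A E) →
      Module.Finite ℝ (𝒪.RepSpace A E) ∧
      Function.Injective (𝒪.groupRep A E) ∧
      (∃ p : Seminorm ℝ (Module.End ℝ (𝒪.RepSpace A E)),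
        (∀ X, p X = 0 → X = 0) ∧ ∀ M : 𝒪.TransfR A A, p (𝒪.rep A E M) = ‖M‖) ∧
      @IsCompact _ (moduleTopology ℝ (Module.End ℝ (𝒪.RepSpace A E)))
        (Set.range fun g : 𝒪.Rev A =>
          (𝒪.groupRep A E g : Module.End ℝ (𝒪.RepSpace A E)))) ∧
    IsCompactLieGroup (𝒪.Rev A) := by
  have hfinA : Module.Finite ℝ (𝒪.TransfR A A) := h𝒪.finite A A
  have hfin : ∀ {N : ℕ} (E : Fin N → C), Module.Finite ℝ (𝒪.RepSpace A E) := fun E => by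
    have : ∀ i, Module.Finite ℝ (𝒪.StR (A ⊗ E i)) := fun i =>
      have := h𝒪.finite (𝟙_ C) (A ⊗ E i)
      𝒪.finite_StR (A ⊗ E i)
    exact Module.Finite.pi
  obtain ⟨N, E, hN, hE⟩ := 𝒪.exists_injective_rep A
  refine ⟨⟨N, E, hN, hE⟩, fun N E hE => ?_, ?_⟩
  · have hV := hfin E
    let b := Module.finBasis ℝ (𝒪.RepSpace A E)
    obtain ⟨hemb, hcomp⟩ := h𝒪.isEmbedding_matrixRep_and_isCompact hE b
    refine ⟨hV, ?_, ?_, ?_⟩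
    · intro g h hgh
      exact hemb.injective (congrArg (fun u => LinearMap.toMatrixAlgEquiv b (Units.val u)) hgh)
    · exact exists_seminorm_comp_eq (𝒪.opSeminorm A A)
        (fun M hM => 𝒪.eq_zero_of_norm_eq_zero (h𝒪.closed A A) hM) (𝒪.rep A E) hE
    · -- The passage from matrices back to operators is linear, hence continuous.
      let _ : TopologicalSpace (Module.End ℝ (𝒪.RepSpace A E)) := moduleTopology ℝ _
      have : IsModuleTopology ℝ (Module.End ℝ (𝒪.RepSpace A E)) := ⟨rfl⟩
      have : IsTopologicalAddGroup (Module.End ℝ (𝒪.RepSpace A E)) :=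
        IsModuleTopology.topologicalAddGroup ℝ _
      let F := (LinearMap.toMatrixAlgEquiv b).symm.toLinearMap
      have hF : Continuous F := F.continuous_of_finiteDimensional
      have himage := hcomp.image hF
      rw [← Set.range_comp] at himage
      convert himage using 2
      funext g
      exact ((LinearMap.toMatrixAlgEquiv b).symm_apply_apply _).symm
  · have hV := hfin E
    let _ : NormedRing (Matrix (Fin (Module.finrank ℝ (𝒪.RepSpace A E)))
      (Fin (Module.finrank ℝ (𝒪.RepSpace A E))) ℝ) := Matrix.linftyOpNormedRing
    let _ : NormedAlgebra ℝ (Matrix (Fin (Module.finrank ℝ (𝒪.RepSpace A E)))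
      (Fin (Module.finrank ℝ (𝒪.RepSpace A E))) ℝ) := Matrix.linftyOpNormedAlgebra
    obtain ⟨hemb, hcomp⟩ :=
      h𝒪.isEmbedding_matrixRep_and_isCompact hE (Module.finBasis ℝ (𝒪.RepSpace A E))
    exact isCompactLieGroup_of_isEmbedding hemb hcomp
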